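/- **Theorem (global convergence of the inexact Newton-CG algorithm for the smallest enclosing ball).** Let $m\ge1$, $c_1,\dots,c_m\in\mathbb R^n$ (centers), $r_1,\dots,r_m\ge0$ (radii), and $f(x)=\max_{1\le i\le m}\left(\|x-c_i\|+r_i\right)$. For $0<\mu\le1$ put $$g_i(x;\mu)=\sqrt{\|x-c_i\|^2+\mu^2},\quad f_i(x;\mu)=g_i(x;\mu)+r_i,\quad f(x;\mu)=\mu\ln\sum_{i=1}^m e^{f_i(x;\mu)/\mu},$$ $$\nabla f_i(x;\mu)=\frac{x-c_i}{g_i(x;\mu)},\qquad \nabla^2 f_i(x;\mu)=\frac{I_n}{g_i(x;\mu)}-\frac{(x-c_i)(x-c_i)^T}{g_i(x;\mu)^3}.$$ For nonempty $S\subseteq\{1,\dots,m\}$ and $i\in S$ let $\lambda_i^S(x;\mu)=e^{f_i(x;\mu)/\mu}\big/\sum_{j\in S}e^{f_j(x;\mu)/\mu}$, $G_S(x;\mu)=\sum_{i\in S}\lambda^S_i\nabla f_i$ and $H_S(x;\mu)=\sum_{i\in S}\left(\lambda^S_i\nabla^2f_i+\tfrac1\mu\lambda_i^S\nabla f_i\nabla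 f_i^T\right)-\tfrac1\mu G_SG_S^T$. For $\epsilon_3\in(0,1]$ the inexact gradient and Hessian at $x$ are $\nabla\tilde f(x;\mu)=G_S(x;\mu)$ and $\nabla^2\tilde f(x;\mu)=H_S(x;\mu)$ with $S=\left\{i:\lambda_i^{\{1,\dots,m\}}(x;\mu)\ge\frac{\mu\epsilon_3}{10m}\right\}$. *Algorithm.* Given $\epsilon_1\ge 0$, $c_1\in(0,1)$ (line-search constant), $\beta\in(0,1)$, $\mu_k$, $\epsilon_2(\mu_k)$, $\epsilon_3(\mu_k)$ and $x_{0,0}\in\mathbb R^n$, the $k$-th inner loop starts at $x_{k,0}$. Pass $j=0,1,2,\dots$ of it (with $\epsilon_3=\epsilon_3(\mu_k)$) computes by the conjugate gradient method, started at $0$, for the equation $\nabla^2\tilde f(x_{k,j};\mu_k)d=-\nabla\tilde f(x_{k,j};\mu_k)$ an iterate $\tilde d_{k,j}$ with $$\|\nabla^2\tilde f(x_{k,j};\mu_k)\tilde d_{k,j}+\nabla\tilde f(x_{k,j};\mu_k)\|\le\min\left\{0.5,\sqrt{\|\nabla\tilde f(x_{k,j};\mu_k)\|}\right\}\|\nabla\tilde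 f(x_{k,j};\mu_k)\|,$$ and sets $x_{k,j+1}=x_{k,j}+\beta^l\tilde d_{k,j}$, where $l\in\{0,1,2,\dots\}$ is smallest with $$f(x_{k,j}+\beta^l\tilde d_{k,j};\mu_k)\le f(x_{k,j};\mu_k)+c_1\beta^l\,\tilde d_{k,j}^T\nabla\tilde f(x_{k,j};\mu_k).$$ The inner loop is left after the first pass that produces $x_{k,j}$ ($j\ge1$) with $\|\nabla\tilde f(x_{k,j};\mu_k)\|\le\epsilon_2(\mu_k)$; this $j$ is called $j_k$. Then $x_{k+1,0}=x_{k,j_k}$, and the algorithm goes on with $k+1$ unless $\mu_{k+1}\le\epsilon_1$. *Claim.* Let $\epsilon_1=0$, let $\mu_k\in(0,1]$ be nonincreasing with $\mu_k\to0$, and let $\epsilon_2(\mu_k)\to0$. For every $k$ let $\sigma_{\max}(\mu_k)\ge\sigma_{\min}(\mu_k)>0$ be such that $$\sigma_{\min}(\mu_k)I_n\preceq H_S(x;\mu_k)\preceq\sigma_{\max}(\mu_k)I_n$$ for all nonempty $S\subseteq\{1,\dots,m\}$ and all $x$ with $f(x;\mu_k)\le f(x_{0,0};\mu_0)$, and let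 $$0<\epsilon_3(\mu_k)\le1,\qquad \epsilon_3(\mu_k)\le\frac{\epsilon_2(\mu_k)}{c_2(\mu_k)},\qquad c_2(\mu_k)>\frac{6\mu_k\sigma_{\max}^2(\mu_k)}{5(1-c_1)\sigma_{\min}^2(\mu_k)}.$$ Let $\{x_{k,j}\}$ be iterates generated by the algorithm, and let $x^*$ be the (unique) minimizer of $f$ on $\mathbb R^n$. Then every inner loop is left after finitely many passes, so that $j_k$ exists for all $k$, and $$\lim_{k\to\infty}x_{k,j_k}=x^*.$$ -/

import Mathlib

open Filter Topology

noncomputable section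

namespace SEB

/-- Euclidean space `ℝⁿ`. -/
abbrev E (n : ℕ) := EuclideanSpace ℝ (Fin n)

/-- The objective `f(x) = max_i (‖x - c_i‖ + r_i)` of the smallest enclosing ball problem for the
balls with centers `c i` and radii `r i`. -/
def obj {m n : ℕ} (c : Fin m → E n) (r : Fin m → ℝ) (x : E n) : ℝ :=
  ⨆ i, (‖x - c i‖ + r i)

/-- `g_i(x; μ) = √(‖x - c_i‖² + μ²)`. -/
def smoothDist {m n : ℕ} (c : Fin m → E n) (μ : ℝ) (i : Fin m) (x : E n) : ℝ :=
  √(‖x - c i‖ ^ 2 + μ ^ 2)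

/-- `exp (f_i(x; μ) / μ)`, where `f_i(x; μ) = g_i(x; μ) + r_i`. -/
def expTerm {m n : ℕ} (c : Fin m → E n) (r : Fin m → ℝ) (μ : ℝ) (i : Fin m) (x : E n) : ℝ :=
  Real.exp ((smoothDist c μ i x + r i) / μ)

/-- The log-exponential aggregation function `f(x; μ) = μ ln (∑_i exp (f_i(x; μ) / μ))`. -/
def smooth {m n : ℕ} (c : Fin m → E n) (r : Fin m → ℝ) (μ : ℝ) (x : E n) : ℝ :=
  μ * Real.log (∑ i, expTerm c r μ i x)

/-- The weight of `i` relative to the index set `S`. For `S` the set of all indices this is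
`λ_i(x; μ)`; for `i ∈ S`, `S` the active set below, it is the truncated weight `λ̃_i(x; μ)`. -/
def weight {m n : ℕ} (c : Fin m → E n) (r : Fin m → ℝ) (μ : ℝ) (S : Finset (Fin m))
    (i : Fin m) (x : E n) : ℝ :=
  expTerm c r μ i x / ∑ j ∈ S, expTerm c r μ j x

/-- `∇f_i(x; μ) = (x - c_i) / g_i(x; μ)`. -/
def gradTerm {m n : ℕ} (c : Fin m → E n) (μ : ℝ) (i : Fin m) (x : E n) : E n :=
  (1 / smoothDist c μ i x) • (x - c i)

/-- `∇²f_i(x; μ) = I / g_i(x; μ) - (x - c_i)(x - c_i)ᵀ / g_i(x; μ)³`. -/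
def hessTerm {m n : ℕ} (c : Fin m → E n) (μ : ℝ) (i : Fin m) (x : E n) : E n →L[ℝ] E n :=
  (1 / smoothDist c μ i x) • ContinuousLinearMap.id ℝ (E n)
    - (1 / smoothDist c μ i x ^ 3) • InnerProductSpace.rankOne ℝ (x - c i) (x - c i)

/-- The gradient of the aggregation function over a fixed index set `S`:
`∑_{i ∈ S} λ̃_i ∇f_i`. -/
def grad {m n : ℕ} (c : Fin m → E n) (r : Fin m → ℝ) (μ : ℝ) (S : Finset (Fin m))
    (x : E n) : E n :=
  ∑ i ∈ S, weight c r μ S i x • gradTerm c μ i x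

/-- The Hessian of the aggregation function over a fixed index set `S`:
`∑_{i ∈ S} (λ̃_i ∇²f_i + (1/μ) λ̃_i ∇f_i ∇f_iᵀ) - (1/μ) ∇f̃ ∇f̃ᵀ`. -/
def hess {m n : ℕ} (c : Fin m → E n) (r : Fin m → ℝ) (μ : ℝ) (S : Finset (Fin m))
    (x : E n) : E n →L[ℝ] E n :=
  (∑ i ∈ S, (weight c r μ S i x • hessTerm c μ i x
      + ((1 / μ) * weight c r μ S i x) •
        InnerProductSpace.rankOne ℝ (gradTerm c μ i x) (gradTerm c μ i x)))
    - (1 / μ) • InnerProductSpace.rankOne ℝ (grad c r μ S x) (grad c r μ S x)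

/-- The active set `S(x; μ, ε) = {i | λ_i(x; μ) ≥ ε}` for `ε = μ ε₃ / (10 m)`. -/
def active {m n : ℕ} (c : Fin m → E n) (r : Fin m → ℝ) (μ ε₃ : ℝ) (x : E n) :
    Finset (Fin m) :=
  {i | μ * ε₃ / (10 * m) ≤ weight c r μ Finset.univ i x}

/-- The inexact gradient `∇f̃(x; μ)`. -/
def inexactGrad {m n : ℕ} (c : Fin m → E n) (r : Fin m → ℝ) (μ ε₃ : ℝ) (x : E n) : E n :=
  grad c r μ (active c r μ ε₃ x) x

/-- The inexact Hessian `∇²f̃(x; μ)`. -/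
def inexactHess {m n : ℕ} (c : Fin m → E n) (r : Fin m → ℝ) (μ ε₃ : ℝ) (x : E n) :
    E n →L[ℝ] E n :=
  hess c r μ (active c r μ ε₃ x) x

/-- State of the conjugate gradient method: iterate `d`, residual `res = H d + b`, and search
direction `p`. -/
structure CGState (n : ℕ) where
  d : E n
  res : E n
  p : E n

/-- One conjugate gradient iteration for `H d = -b`. Once the residual vanishes, so does `p`, and
the state no longer changes. -/
def cgNext {n : ℕ} (H : E n →L[ℝ] E n) (s : CGState n) : CGState n :=
  let a : ℝ := inner ℝ s.res s.res / inner ℝ s.p (H s.p)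
  let res' : E n := s.res + a • H s.p
  let b : ℝ := inner ℝ res' res' / inner ℝ s.res s.res
  { d := s.d + a • s.p, res := res', p := -res' + b • s.p }

/-- The conjugate gradient method for `H d = -b`, started at `d = 0`. -/
def cg {n : ℕ} (H : E n →L[ℝ] E n) (b : E n) : ℕ → CGState n
  | 0 => { d := 0, res := b, p := -b }
  | N + 1 => cgNext H (cg H b N)

/-- `d` is a search direction at `x`: a conjugate gradient iterate for the inexact Newton equation
`∇²f̃(x; μ) d = -∇f̃(x; μ)` that meets the relative accuracy
`η̃ = min {1/2, √‖∇f̃(x; μ)‖}`. -/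
def IsDirection {m n : ℕ} (c : Fin m → E n) (r : Fin m → ℝ) (μ ε₃ : ℝ) (x d : E n) : Prop :=
  (∃ N, d = (cg (inexactHess c r μ ε₃ x) (inexactGrad c r μ ε₃ x) N).d) ∧
    ‖inexactHess c r μ ε₃ x d + inexactGrad c r μ ε₃ x‖
      ≤ min (1 / 2) √‖inexactGrad c r μ ε₃ x‖ * ‖inexactGrad c r μ ε₃ x‖

/-- One pass through the body of the inner loop leads from `x` to `y`: a search direction `d` is
computed, and `y = x + β ^ l • d` for the smallest `l = 0, 1, 2, …` that satisfies the sufficient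
decrease condition. -/
def IsStep {m n : ℕ} (c : Fin m → E n) (r : Fin m → ℝ) (c₁ β μ ε₃ : ℝ) (x y : E n) : Prop :=
  ∃ d, IsDirection c r μ ε₃ x d ∧ ∃ l : ℕ,
    IsLeast {l : ℕ | smooth c r μ (x + β ^ l • d)
      ≤ smooth c r μ x + c₁ * β ^ l * inner ℝ d (inexactGrad c r μ ε₃ x)} l ∧
    y = x + β ^ l • d

/-- The exit test of the inner loop at smoothing level `μ`: `‖∇f̃(y; μ)‖ ≤ ε₂(μ)`. -/
def Stops {m n : ℕ} (c : Fin m → E n) (r : Fin m → ℝ) (ε₂ ε₃ : ℝ → ℝ) (μ : ℝ) (y : E n) :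
    Prop :=
  ‖inexactGrad c r μ (ε₃ μ) y‖ ≤ ε₂ μ

/-- `j` is the number of passes after which inner loop `k` is left: the first `j ≥ 1` at which the
exit test holds (the test comes after the body). -/
def IsExit {m n : ℕ} (c : Fin m → E n) (r : Fin m → ℝ) (μ : ℕ → ℝ) (ε₂ ε₃ : ℝ → ℝ)
    (x : ℕ → ℕ → E n) (k j : ℕ) : Prop :=
  IsLeast {j : ℕ | 1 ≤ j ∧ Stops c r ε₂ ε₃ (μ k) (x k j)} j

/-- Inner loop `k` is entered: every earlier inner loop is left after finitely many passes, and
the exit test `μ ≤ ε₁` of the outer loop fails after each of them. -/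
def Enters {m n : ℕ} (c : Fin m → E n) (r : Fin m → ℝ) (ε₁ : ℝ) (μ : ℕ → ℝ) (ε₂ ε₃ : ℝ → ℝ)
    (x : ℕ → ℕ → E n) (k : ℕ) : Prop :=
  ∀ i < k, (∃ j, IsExit c r μ ε₂ ε₃ x i j) ∧ ε₁ < μ (i + 1)

/-- The iterates `x k j` are generated by the inexact Newton-CG algorithm from `x₀₀`. Nothing is
said about entries of `x` that the algorithm does not reach, and it is not presupposed that any
inner loop is ever left. -/
structure IsRun {m n : ℕ} (c : Fin m → E n) (r : Fin m → ℝ) (ε₁ c₁ β : ℝ) (μ : ℕ → ℝ)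
    (ε₂ ε₃ : ℝ → ℝ) (x₀₀ : E n) (x : ℕ → ℕ → E n) : Prop where
  start : x 0 0 = x₀₀
  step : ∀ k j, Enters c r ε₁ μ ε₂ ε₃ x k →
    (∀ i, 1 ≤ i → i ≤ j → ¬ Stops c r ε₂ ε₃ (μ k) (x k i)) →
    IsStep c r c₁ β (μ k) (ε₃ (μ k)) (x k j) (x k (j + 1))
  next : ∀ k j, Enters c r ε₁ μ ε₂ ε₃ x (k + 1) → IsExit c r μ ε₂ ε₃ x k j →
    x (k + 1) 0 = x k j

/-- `σmin I ≼ ∇²f̃(x; μ) ≼ σmax I` with `0 < σmin ≤ σmax`, for every `x` in the level set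
`{x | f(x; μ) ≤ f₀}` and the Hessian formed over any nonempty index set. -/
def HessBounds {m n : ℕ} (c : Fin m → E n) (r : Fin m → ℝ) (f₀ μ σmin σmax : ℝ) : Prop :=
  0 < σmin ∧ σmin ≤ σmax ∧
    ∀ x : E n, smooth c r μ x ≤ f₀ → ∀ S : Finset (Fin m), S.Nonempty → ∀ v : E n,
      σmin * ‖v‖ ^ 2 ≤ inner ℝ v (hess c r μ S x v) ∧
        inner ℝ v (hess c r μ S x v) ≤ σmax * ‖v‖ ^ 2

end SEB

end

/-! Within one inner loop everything rests on a decrease that is uniform over the level set. A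
conjugate gradient iterate `d` is orthogonal to its residual, so its slope along the inexact
gradient is `-⟨d, H d⟩ ≤ -σmin ‖d‖²`; the relative residual of at most 1/2 gives `‖∇f̃‖ ≤ 2 σmax
‖d‖`. The discarded weights sum to at most `μ ε₃ / 10`, so the gradient error is at most `μ ε₃ / 5`,
and the condition on `c₂` makes this small against `σmin ‖d‖` while the exit test fails. With a
quadratic upper model of the smooth function, all steps below a threshold independent of the point
are accepted. Each such pass thus gains a fixed amount, and a nonnegative function allows only
finitely many (`exists_exit_of_steps`).

The smooth function is nondecreasing in `μ`, so the level set bound passes from loop to loop. At the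
exits the exact gradients tend to zero; convexity then forces the objective gap to zero, and
quadratic growth at the minimizer yields convergence (`tendsto_of_norm_grad_tendsto`). -/

namespace SEB

/-! ### Conjugate gradient iterates as descent directions. -/

section ConjugateGradient

variable {n : ℕ} {H : E n →L[ℝ] E n} {b : E n}

lemma cg_res_eq (N : ℕ) : (cg H b N).res = H (cg H b N).d + b := by
  induction N with
  | zero => simp [cg]
  | succ N ih => simp only [cg, cgNext, map_add, map_smul, ih]; abel

lemma cg_p_eq_zero (N : ℕ) (h : (cg H b N).res = 0) : (cg H b N).p = 0 := by
  cases N with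
  | zero => simpa [cg] using h
  | succ N =>
    simp only [cg, cgNext] at h ⊢
    rw [h]
    simp

/-- Orthogonality of residuals and search directions, and conjugacy of the search directions. -/
lemma cg_invariant (hsymm : ∀ v w, inner ℝ (H v) w = inner ℝ v (H w))
    (hpos : ∀ v, v ≠ 0 → 0 < inner ℝ v (H v)) (N : ℕ) :
    inner ℝ (cg H b N).res (cg H b N).p = -inner ℝ (cg H b N).res (cg H b N).res ∧
    (∀ j < N, inner ℝ (cg H b N).res (cg H b j).p = 0) ∧
    (∀ j < N, inner ℝ (cg H b N).p (H (cg H b j).p) = 0) := by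
  induction N with
  | zero => simp [cg]
  | succ N ih =>
    obtain ⟨h1, h2, h3⟩ := ih
    set s := cg H b N with hs
    set a : ℝ := inner ℝ s.res s.res / inner ℝ s.p (H s.p) with ha
    have hres : (cg H b (N + 1)).res = s.res + a • H s.p := rfl
    set r' := (cg H b (N + 1)).res with hr'
    have hp : (cg H b (N + 1)).p = -r' + (inner ℝ r' r' / inner ℝ s.res s.res : ℝ) • s.p := rfl
    have hrp : ∀ j < N + 1, inner ℝ r' (cg H b j).p = 0 := by
      intro j hj
      rw [hres, inner_add_left, inner_smul_left, hsymm]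
      rcases Nat.lt_succ_iff_lt_or_eq.1 hj with hj | rfl
      · simp [h2 j hj, h3 j hj]
      · rw [← hs, h1]
        -- Once `p` vanishes, `h1` makes the residual vanish too, so the 0/0 in the step length is
        -- harmless.
        by_cases hp0 : s.p = 0
        · have : s.res = 0 := by
            rw [hp0] at h1; simpa using h1.symm
          simp [hp0, this]
        · have := (hpos _ hp0).ne'
          simp only [ha, conj_trivial]
          field_simp
          ring
    -- Each residual is a combination of the search directions `p_j` and `p_{j-1}`, and the first
    -- one is `-p_0`.
    have hrr : ∀ j < N + 1, inner ℝ r' (cg H b j).res = 0 := by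
      intro j hj
      cases j with
      | zero =>
        have := hrp 0 hj
        simpa [cg] using this
      | succ j =>
        have e1 := hrp (j + 1) hj
        have e2 := hrp j (by omega)
        have : (cg H b (j + 1)).p = -(cg H b (j + 1)).res + (inner ℝ (cg H b (j + 1)).res
          (cg H b (j + 1)).res / inner ℝ (cg H b j).res (cg H b j).res : ℝ) • (cg H b j).p := rfl
        rw [this, inner_add_right, inner_smul_right, e2, inner_neg_right] at e1
        simpa using e1
    refine ⟨?_, hrp, ?_⟩
    · rw [hp, inner_add_right, inner_smul_right, hrp N (by omega), inner_neg_right]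
      simp
    · intro j hj
      set t := cg H b j with ht
      by_cases hp0 : t.p = 0
      · simp [hp0]
      have hr0 : t.res ≠ 0 := fun h => hp0 (cg_p_eq_zero j h)
      have hpp := hpos _ hp0
      have hrr0 : 0 < inner ℝ t.res t.res := real_inner_self_pos.2 hr0
      -- `H p_j` is a multiple of the difference of two consecutive residuals, which reduces
      -- conjugacy to orthogonality of residuals. Only for `j = N` does a term survive, and the
      -- coefficient of `p` in the new direction cancels it.
      have hnext : (cg H b (j + 1)).res
        = t.res + (inner ℝ t.res t.res / inner ℝ t.p (H t.p) : ℝ) • H t.p := rfl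
      have e := congrArg (fun z => inner ℝ r' z) hnext
      have er : inner ℝ r' t.res = 0 := hrr j hj
      simp only [inner_add_right, inner_smul_right, er, zero_add] at e
      rw [hp, inner_add_left, inner_smul_left, inner_neg_left]
      rcases Nat.lt_succ_iff_lt_or_eq.1 hj with hj | rfl
      · rw [hrr (j + 1) (by omega)] at e
        have : inner ℝ r' (H t.p) = 0 := by
          have h0 : (inner ℝ t.res t.res / inner ℝ t.p (H t.p) : ℝ) ≠ 0 := by positivity
          exact (mul_eq_zero.1 e.symm).resolve_left h0
        rw [this, h3 j hj]
        simp
      · have hst : s = t := rfl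
        rw [hst]
        rw [← hr'] at e
        simp only [conj_trivial]
        rw [e]
        field_simp
        ring

/-- The residual of a conjugate gradient iterate is orthogonal to the iterate. -/
lemma cg_inner_d_eq_zero (hsymm : ∀ v w, inner ℝ (H v) w = inner ℝ v (H w))
    (hpos : ∀ v, v ≠ 0 → 0 < inner ℝ v (H v)) (N : ℕ) :
    inner ℝ (cg H b N).res (cg H b N).d = 0 := by
  have key : ∀ M ≤ N, inner ℝ (cg H b N).res (cg H b M).d = 0 := by
    intro M hM
    induction M with
    | zero => simp [cg]
    | succ M ih =>
      have : (cg H b (M + 1)).d = (cg H b M).d + (inner ℝ (cg H b M).res (cg H b M).res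
        / inner ℝ (cg H b M).p (H (cg H b M).p) : ℝ) • (cg H b M).p := rfl
      rw [this, inner_add_right, inner_smul_right, ih (by omega),
        (cg_invariant hsymm hpos N).2.1 M (by omega)]
      simp
  exact key N le_rfl

/-- Orthogonality of `d` to the residual `H d + b`. It makes every iterate a descent direction,
however inexact the solve. -/
lemma inner_cg_eq (hsymm : ∀ v w, inner ℝ (H v) w = inner ℝ v (H w))
    (hpos : ∀ v, v ≠ 0 → 0 < inner ℝ v (H v)) (N : ℕ) :
    inner ℝ (cg H b N).d b = -inner ℝ (cg H b N).d (H (cg H b N).d) := by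
  have h := cg_inner_d_eq_zero (b := b) hsymm hpos N
  rw [cg_res_eq, real_inner_comm, inner_add_right] at h
  linarith

/-- A quadratic form bound gives a bound of the operator. -/
lemma norm_apply_le_of_inner_le (hsymm : ∀ v w, inner ℝ (H v) w = inner ℝ v (H w)) {σ : ℝ}
    (hσ : 0 < σ) (hlow : ∀ v, 0 ≤ inner ℝ v (H v)) (hup : ∀ v, inner ℝ v (H v) ≤ σ * ‖v‖ ^ 2)
    (v : E n) : ‖H v‖ ≤ σ * ‖v‖ := by
  -- Expanding the form at `σ v - H v` and bounding its two pure terms by `hup` leaves `σ (σ² ‖v‖² -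
  -- ‖H v‖²) ≥ 0`.
  have h1 := hlow (σ • v - H v)
  have h2 := hup (H v)
  have h3 := hup v
  simp only [map_sub, map_smul, inner_sub_left, inner_sub_right, real_inner_smul_left,
    inner_smul_right, real_inner_self_eq_norm_sq, ← hsymm v (H v)] at h1 h2
  have h4 : 0 ≤ σ * (σ ^ 2 * ‖v‖ ^ 2 - ‖H v‖ ^ 2) := by nlinarith
  have h5 : ‖H v‖ ^ 2 ≤ (σ * ‖v‖) ^ 2 := by
    have := nonneg_of_mul_nonneg_right h4 hσ
    nlinarith
  exact le_of_sq_le_sq h5 (by positivity)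

end ConjugateGradient

/-! ### The aggregation function: truncation error, quadratic model, convexity. -/

section Basic

variable {m n : ℕ} {c : Fin m → E n} {r : Fin m → ℝ} {μ : ℝ}

lemma smoothDist_pos (hμ : 0 < μ) (i : Fin m) (x : E n) : 0 < smoothDist c μ i x := by
  unfold smoothDist; positivity

lemma smoothDist_sq (i : Fin m) (x : E n) :
    smoothDist c μ i x ^ 2 = ‖x - c i‖ ^ 2 + μ ^ 2 := Real.sq_sqrt (by positivity)

lemma le_smoothDist (i : Fin m) (x : E n) : μ ≤ smoothDist c μ i x :=
  Real.le_sqrt_of_sq_le (by nlinarith [sq_nonneg ‖x - c i‖])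

lemma norm_le_smoothDist (i : Fin m) (x : E n) : ‖x - c i‖ ≤ smoothDist c μ i x :=
  Real.le_sqrt_of_sq_le (by nlinarith [sq_nonneg μ])

lemma smoothDist_le (hμ : 0 < μ) (i : Fin m) (x : E n) :
    smoothDist c μ i x ≤ ‖x - c i‖ + μ :=
  (Real.sqrt_le_left (by positivity)).2 (by nlinarith [norm_nonneg (x - c i)])

lemma norm_gradTerm_le_one (hμ : 0 < μ) (i : Fin m) (x : E n) : ‖gradTerm c μ i x‖ ≤ 1 := by
  have := smoothDist_pos (c := c) hμ i x
  rw [gradTerm, norm_smul, Real.norm_of_nonneg (by positivity), one_div, inv_mul_le_iff₀ this,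
    mul_one]
  exact norm_le_smoothDist i x

lemma expTerm_pos (i : Fin m) (x : E n) : 0 < expTerm c r μ i x := Real.exp_pos _

lemma weight_nonneg (S : Finset (Fin m)) (i : Fin m) (x : E n) : 0 ≤ weight c r μ S i x :=
  div_nonneg (expTerm_pos i x).le (Finset.sum_nonneg fun j _ => (expTerm_pos j x).le)

lemma sum_expTerm_pos {S : Finset (Fin m)} (hS : S.Nonempty) (x : E n) :
    0 < ∑ i ∈ S, expTerm c r μ i x := Finset.sum_pos (fun j _ => expTerm_pos j x) hS

lemma sum_weight {S : Finset (Fin m)} (hS : S.Nonempty) (x : E n) :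
    ∑ i ∈ S, weight c r μ S i x = 1 := by
  unfold weight
  rw [← Finset.sum_div, div_self (sum_expTerm_pos hS x).ne']

lemma norm_grad_le_one (hμ : 0 < μ) {S : Finset (Fin m)} (hS : S.Nonempty) (x : E n) :
    ‖grad c r μ S x‖ ≤ 1 := by
  rw [← sum_weight (c := c) (r := r) (μ := μ) hS x]
  refine norm_sum_le_of_le _ fun i _ => ?_
  rw [norm_smul, Real.norm_of_nonneg (weight_nonneg S i x)]
  exact mul_le_of_le_one_right (weight_nonneg S i x) (norm_gradTerm_le_one hμ i x)

lemma hess_symm (S : Finset (Fin m)) (x v w : E n) :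
    inner ℝ (hess c r μ S x v) w = inner ℝ v (hess c r μ S x w) := by
  simp only [hess, hessTerm, sub_apply, sum_apply,
    add_apply, smul_apply,
    ContinuousLinearMap.id_apply, InnerProductSpace.rankOne_apply, inner_sub_left,
    inner_sub_right, inner_add_left, inner_add_right, sum_inner, inner_sum,
    real_inner_smul_left, inner_smul_right]
  congr 1
  · refine Finset.sum_congr rfl fun i _ => ?_
    rw [real_inner_comm v x, real_inner_comm v (c i), real_inner_comm v (gradTerm c μ i x)]
    ring
  · rw [real_inner_comm v]; ring

/-- Otherwise the `m` weights would sum to at most `μ ε / 10 < 1`. -/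
lemma active_nonempty (hm : 1 ≤ m) (hμ : 0 < μ ∧ μ ≤ 1) {ε : ℝ} (hε : 0 < ε ∧ ε ≤ 1)
    (x : E n) : (active c r μ ε x).Nonempty := by
  have hm' : (0 : ℝ) < m := by exact_mod_cast hm
  have : Nonempty (Fin m) := ⟨⟨0, hm⟩⟩
  by_contra h
  rw [Finset.not_nonempty_iff_eq_empty] at h
  have hlt : ∀ i, weight c r μ Finset.univ i x ≤ μ * ε / (10 * m) := fun i => by
    have : i ∉ active c r μ ε x := by simp [h]
    simp only [active, Finset.mem_filter_univ, not_le] at this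
    exact this.le
  have h1 := sum_weight (c := c) (r := r) (μ := μ) Finset.univ_nonempty x
  have h2 := Finset.sum_le_card_nsmul Finset.univ _ _ fun i _ => hlt i
  rw [h1, Finset.card_univ, Fintype.card_fin, nsmul_eq_mul] at h2
  have h3 : (m : ℝ) * (μ * ε / (10 * m)) = μ * ε / 10 := by field_simp
  nlinarith [hμ.1, hμ.2, hε.1, hε.2]

/-- The error of the inexact gradient. -/
lemma norm_grad_sub_inexactGrad_le (hm : 1 ≤ m) (hμ : 0 < μ ∧ μ ≤ 1) {ε : ℝ}
    (hε : 0 < ε ∧ ε ≤ 1) (x : E n) :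
    ‖grad c r μ Finset.univ x - inexactGrad c r μ ε x‖ ≤ μ * ε / 5 := by
  have hm' : (0 : ℝ) < m := by exact_mod_cast hm
  have : Nonempty (Fin m) := ⟨⟨0, hm⟩⟩
  have hS := active_nonempty (c := c) (r := r) hm hμ hε x
  unfold inexactGrad
  set S := active c r μ ε x with hSdef
  set w := fun i => weight c r μ Finset.univ i x with hw
  have hw0 : ∀ i, 0 ≤ w i := fun i => weight_nonneg _ i x
  have hsum : ∑ i ∈ S, w i + ∑ i ∈ Sᶜ, w i = 1 := by
    rw [Finset.sum_add_sum_compl]; exact sum_weight Finset.univ_nonempty x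
  have hcompl : ∑ i ∈ Sᶜ, w i ≤ μ * ε / 10 := by
    have h2 : ∑ i ∈ Sᶜ, w i ≤ ∑ i ∈ Sᶜ, μ * ε / (10 * m) := by
      refine Finset.sum_le_sum fun i hi => ?_
      have hi : i ∉ active c r μ ε x := Finset.mem_compl.1 hi
      simp only [active, Finset.mem_filter_univ, not_le] at hi
      exact hi.le
    refine h2.trans ?_
    rw [Finset.sum_const, nsmul_eq_mul]
    have hcard : ((Sᶜ.card : ℕ) : ℝ) ≤ m := by
      exact_mod_cast (Finset.card_le_univ _).trans (by simp)
    have := hμ.1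
    have := hε.1
    calc (Sᶜ.card : ℝ) * (μ * ε / (10 * m)) ≤ m * (μ * ε / (10 * m)) := by gcongr
      _ = μ * ε / 10 := by field_simp
  have hsm : (∑ i ∈ S, w i) • grad c r μ S x = ∑ i ∈ S, w i • gradTerm c μ i x := by
    rw [grad, Finset.smul_sum]
    refine Finset.sum_congr rfl fun i _ => ?_
    rw [smul_smul]
    congr 1
    have h1 := (sum_expTerm_pos (c := c) (r := r) (μ := μ) hS x).ne'
    have h2 := (sum_expTerm_pos (c := c) (r := r) (μ := μ) Finset.univ_nonempty x).ne'
    simp only [hw, weight, ← Finset.sum_div]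
    field_simp
  -- The error is the discarded part minus the excess from renormalizing the kept weights. Each is
  -- bounded by the discarded mass, hence twice `μ ε / 10`.
  have hdecomp : grad c r μ Finset.univ x - grad c r μ S x
      = ∑ i ∈ Sᶜ, w i • gradTerm c μ i x - (∑ i ∈ Sᶜ, w i) • grad c r μ S x := by
    have h1 : grad c r μ Finset.univ x
        = ∑ i ∈ S, w i • gradTerm c μ i x + ∑ i ∈ Sᶜ, w i • gradTerm c μ i x := by
      rw [Finset.sum_add_sum_compl]; rfl
    have h2 : ∑ i ∈ Sᶜ, w i = 1 - ∑ i ∈ S, w i := by linarith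
    rw [h1, ← hsm, h2]
    module
  have hb1 : ‖∑ i ∈ Sᶜ, w i • gradTerm c μ i x‖ ≤ ∑ i ∈ Sᶜ, w i := by
    refine norm_sum_le_of_le _ fun i _ => ?_
    rw [norm_smul, Real.norm_of_nonneg (hw0 i)]
    exact mul_le_of_le_one_right (hw0 i) (norm_gradTerm_le_one hμ.1 i x)
  have hb2 : ‖(∑ i ∈ Sᶜ, w i) • grad c r μ S x‖ ≤ ∑ i ∈ Sᶜ, w i := by
    have h0 : 0 ≤ ∑ i ∈ Sᶜ, w i := Finset.sum_nonneg fun i _ => hw0 i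
    rw [norm_smul, Real.norm_of_nonneg h0]
    exact mul_le_of_le_one_right h0 (norm_grad_le_one hμ.1 hS x)
  rw [hdecomp]
  linarith [norm_sub_le (∑ i ∈ Sᶜ, w i • gradTerm c μ i x) ((∑ i ∈ Sᶜ, w i) • grad c r μ S x)]

/-- With `g`, `g'` the old and new values, the quadratic model with `2 g` in place of `2 μ` exceeds
`g'` by exactly `(g' - g)² / (2 g)`; then `g ≥ μ`. -/
lemma smoothDist_add_le (hμ : 0 < μ) (i : Fin m) (x h : E n) :
    smoothDist c μ i (x + h)
      ≤ smoothDist c μ i x + inner ℝ (gradTerm c μ i x) h + ‖h‖ ^ 2 / (2 * μ) := by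
  have hg := smoothDist_pos (c := c) hμ i x
  have hgμ := le_smoothDist (c := c) (μ := μ) i x
  have hsq := smoothDist_sq (c := c) (μ := μ) i x
  have hsq' := smoothDist_sq (c := c) (μ := μ) i (x + h)
  have hexp : ‖x + h - c i‖ ^ 2 = ‖x - c i‖ ^ 2 + 2 * inner ℝ (x - c i) h + ‖h‖ ^ 2 := by
    rw [show x + h - c i = (x - c i) + h by abel, norm_add_sq_real]
  rw [gradTerm, real_inner_smul_left]
  set g := smoothDist c μ i x
  set g' := smoothDist c μ i (x + h)
  set p : ℝ := inner ℝ (x - c i) h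
  have h1 : g' ≤ g + 1 / g * p + ‖h‖ ^ 2 / (2 * g) := by
    have : g + 1 / g * p + ‖h‖ ^ 2 / (2 * g) - g' = (g' - g) ^ 2 / (2 * g) := by
      field_simp
      nlinarith
    have h0 : 0 ≤ (g' - g) ^ 2 / (2 * g) := by positivity
    linarith
  have h2 : ‖h‖ ^ 2 / (2 * g) ≤ ‖h‖ ^ 2 / (2 * μ) := by gcongr
  linarith

/-- Cauchy–Schwarz for `(x - c i, μ)` and `(x + h - c i, μ)` in one dimension more. -/
lemma le_smoothDist_add (hμ : 0 < μ) (i : Fin m) (x h : E n) :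
    smoothDist c μ i x + inner ℝ (gradTerm c μ i x) h ≤ smoothDist c μ i (x + h) := by
  have hg := smoothDist_pos (c := c) hμ i x
  have hg' := smoothDist_pos (c := c) hμ i (x + h)
  have hsq := smoothDist_sq (c := c) (μ := μ) i x
  have hsq' := smoothDist_sq (c := c) (μ := μ) i (x + h)
  have hexp : ‖x + h - c i‖ ^ 2 = ‖x - c i‖ ^ 2 + 2 * inner ℝ (x - c i) h + ‖h‖ ^ 2 := by
    rw [show x + h - c i = (x - c i) + h by abel, norm_add_sq_real]
  have hcs := abs_le.1 (abs_real_inner_le_norm (x - c i) h)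
  have hcs2 : (inner ℝ (x - c i) h : ℝ) ^ 2 ≤ (‖x - c i‖ * ‖h‖) ^ 2 := sq_le_sq' hcs.1 hcs.2
  rw [gradTerm, real_inner_smul_left]
  set g := smoothDist c μ i x
  set g' := smoothDist c μ i (x + h)
  set p : ℝ := inner ℝ (x - c i) h
  have h1 : g ^ 2 + p ≤ g * g' := by
    refine le_of_sq_le_sq ?_ (by positivity)
    have : (g * g') ^ 2 = g ^ 2 * (g ^ 2 + 2 * p + ‖h‖ ^ 2) := by
      rw [mul_pow, hsq', hexp, hsq]; ring
    rw [this, hsq]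
    nlinarith [sq_nonneg (μ * ‖h‖)]
  have h2 : g + 1 / g * p = (g ^ 2 + p) / g := by field_simp
  rw [h2, div_le_iff₀ hg]
  linarith

lemma expTerm_eq_mul (i : Fin m) (x y : E n) :
    expTerm c r μ i y
      = expTerm c r μ i x * Real.exp ((smoothDist c μ i y - smoothDist c μ i x) / μ) := by
  rw [expTerm, expTerm, ← Real.exp_add]
  congr 1
  ring

/-- The increment as the logarithm of a weighted mean of exponentials: bounds on `exp` then give
both the upper model and convexity, without differentiating. -/
lemma smooth_eq_add (hm : 1 ≤ m) (x y : E n) :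
    smooth c r μ y = smooth c r μ x + μ * Real.log (∑ i, weight c r μ Finset.univ i x *
      Real.exp ((smoothDist c μ i y - smoothDist c μ i x) / μ)) := by
  have : Nonempty (Fin m) := ⟨⟨0, hm⟩⟩
  have h0 := sum_expTerm_pos (c := c) (r := r) (μ := μ) Finset.univ_nonempty x
  have h1 := sum_expTerm_pos (c := c) (r := r) (μ := μ) Finset.univ_nonempty y
  have : ∑ i, weight c r μ Finset.univ i x *
      Real.exp ((smoothDist c μ i y - smoothDist c μ i x) / μ)
      = (∑ i, expTerm c r μ i y) / ∑ i, expTerm c r μ i x := by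
    rw [Finset.sum_div]
    refine Finset.sum_congr rfl fun i _ => ?_
    rw [expTerm_eq_mul i x y, weight]
    ring
  rw [this, Real.log_div h1.ne' h0.ne', smooth, smooth]
  ring

lemma inner_grad (S : Finset (Fin m)) (x h : E n) :
    inner ℝ (grad c r μ S x) h
      = ∑ i ∈ S, weight c r μ S i x * inner ℝ (gradTerm c μ i x) h := by
  simp [grad, sum_inner, real_inner_smul_left]

/-- Quadratic upper model of the aggregation function. -/
lemma smooth_add_le (hm : 1 ≤ m) (hμ : 0 < μ) (x h : E n) (hh : ‖h‖ ≤ μ) :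
    smooth c r μ (x + h)
      ≤ smooth c r μ x + inner ℝ (grad c r μ Finset.univ x) h + 3 / (2 * μ) * ‖h‖ ^ 2 := by
  have : Nonempty (Fin m) := ⟨⟨0, hm⟩⟩
  set w := fun i => weight c r μ Finset.univ i x with hw
  have hw0 : ∀ i, 0 ≤ w i := fun i => weight_nonneg _ i x
  have hw1 : ∑ i, w i = 1 := sum_weight Finset.univ_nonempty x
  set a : Fin m → ℝ := fun i => inner ℝ (gradTerm c μ i x) h with ha
  have hab : ∀ i, |a i| ≤ ‖h‖ := fun i =>
    (abs_real_inner_le_norm _ _).trans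
      (mul_le_of_le_one_left (norm_nonneg _) (norm_gradTerm_le_one hμ i x))
  set q := ‖h‖ ^ 2 / (2 * μ) with hq
  have hterm : ∀ i, w i * Real.exp ((smoothDist c μ i (x + h) - smoothDist c μ i x) / μ)
      ≤ Real.exp (q / μ) * (w i + w i * a i / μ + w i * (‖h‖ ^ 2 / μ ^ 2)) := by
    intro i
    have h1 : Real.exp ((smoothDist c μ i (x + h) - smoothDist c μ i x) / μ)
        ≤ Real.exp (q / μ) * Real.exp (a i / μ) := by
      rw [← Real.exp_add, Real.exp_le_exp, ← add_div]
      gcongr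
      linarith [smoothDist_add_le (c := c) hμ i x h]
    have habs : |a i / μ| ≤ 1 := by
      rw [abs_div, abs_of_pos hμ, div_le_one hμ]; exact (hab i).trans hh
    -- `exp s ≤ 1 + s + s²` for `|s| ≤ 1`, whence `‖h‖ ≤ μ`. This contributes `1 / μ` to the final
    -- `3 / (2 μ)`; the curvature of the distances contributes `1 / (2 μ)`.
    have h2 : Real.exp (a i / μ) ≤ 1 + a i / μ + ‖h‖ ^ 2 / μ ^ 2 := by
      have h3 := (abs_le.1 (Real.abs_exp_sub_one_sub_id_le habs)).2
      have h4 : (a i / μ) ^ 2 ≤ ‖h‖ ^ 2 / μ ^ 2 := by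
        rw [div_pow]
        refine div_le_div_of_nonneg_right ?_ (by positivity)
        exact sq_le_sq' (abs_le.1 (hab i)).1 (abs_le.1 (hab i)).2
      linarith
    calc _ ≤ w i * (Real.exp (q / μ) * (1 + a i / μ + ‖h‖ ^ 2 / μ ^ 2)) := by
          refine mul_le_mul_of_nonneg_left (h1.trans ?_) (hw0 i)
          gcongr
      _ = _ := by ring
  have hsum := Finset.sum_le_sum fun i (_ : i ∈ Finset.univ) => hterm i
  rw [← Finset.mul_sum, Finset.sum_add_distrib, Finset.sum_add_distrib, ← Finset.sum_mul, hw1,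
    ← Finset.sum_div, ← inner_grad Finset.univ x h, one_mul] at hsum
  set G : ℝ := inner ℝ (grad c r μ Finset.univ x) h
  have hpos : 0 < ∑ i, w i * Real.exp ((smoothDist c μ i (x + h) - smoothDist c μ i x) / μ) := by
    refine Finset.sum_pos (fun i _ => ?_) Finset.univ_nonempty
    have : 0 < w i := div_pos (expTerm_pos i x) (sum_expTerm_pos Finset.univ_nonempty x)
    positivity
  have hlog : Real.log (∑ i, w i *
      Real.exp ((smoothDist c μ i (x + h) - smoothDist c μ i x) / μ))
      ≤ q / μ + (G / μ + ‖h‖ ^ 2 / μ ^ 2) := by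
    rw [Real.log_le_iff_le_exp hpos, Real.exp_add]
    refine hsum.trans ?_
    gcongr
    linarith [Real.add_one_le_exp (G / μ + ‖h‖ ^ 2 / μ ^ 2)]
  rw [smooth_eq_add hm x (x + h)]
  have := mul_le_mul_of_nonneg_left hlog hμ.le
  have e : μ * (q / μ + (G / μ + ‖h‖ ^ 2 / μ ^ 2)) = G + 3 / (2 * μ) * ‖h‖ ^ 2 := by
    rw [hq]; field_simp; ring
  linarith

/-- The gradient inequality for the convex aggregation function. -/
lemma le_smooth_add (hm : 1 ≤ m) (hμ : 0 < μ) (x h : E n) :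
    smooth c r μ x + inner ℝ (grad c r μ Finset.univ x) h ≤ smooth c r μ (x + h) := by
  have : Nonempty (Fin m) := ⟨⟨0, hm⟩⟩
  rw [smooth_eq_add hm x (x + h), inner_grad]
  set w := fun i => weight c r μ Finset.univ i x with hw
  have hw0 : ∀ i, 0 ≤ w i := fun i => weight_nonneg _ i x
  have hw1 : ∑ i, w i = 1 := sum_weight Finset.univ_nonempty x
  -- Jensen's inequality bounds the log of the mean below by the mean of the exponents.
  have hj := convexOn_exp.map_sum_le (t := Finset.univ) (w := w)
    (p := fun i => (smoothDist c μ i (x + h) - smoothDist c μ i x) / μ)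
    (fun i _ => hw0 i) hw1 (fun i _ => Set.mem_univ _)
  simp only [smul_eq_mul] at hj
  have hl := (Real.le_log_iff_exp_le ((Real.exp_pos _).trans_le hj)).2 hj
  have h1 := mul_le_mul_of_nonneg_left hl hμ.le
  have h2 : ∑ i, w i * inner ℝ (gradTerm c μ i x) h
      ≤ μ * ∑ i, w i * ((smoothDist c μ i (x + h) - smoothDist c μ i x) / μ) := by
    rw [Finset.mul_sum]
    refine Finset.sum_le_sum fun i _ => ?_
    have e : μ * (w i * ((smoothDist c μ i (x + h) - smoothDist c μ i x) / μ))
      = w i * (smoothDist c μ i (x + h) - smoothDist c μ i x) := by field_simp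
    rw [e]
    exact mul_le_mul_of_nonneg_left (by linarith [le_smoothDist_add (c := c) hμ i x h]) (hw0 i)
  linarith

/-! ### Comparison with the objective, monotonicity in `μ`, quadratic growth. -/

lemma le_obj (i : Fin m) (x : E n) : ‖x - c i‖ + r i ≤ obj c r x :=
  le_ciSup (f := fun i => ‖x - c i‖ + r i) (Set.finite_range _).bddAbove i

lemma obj_le_smooth (hm : 1 ≤ m) (hμ : 0 < μ) (x : E n) : obj c r x ≤ smooth c r μ x := by
  have : Nonempty (Fin m) := ⟨⟨0, hm⟩⟩
  refine ciSup_le fun i => ?_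
  have h1 : expTerm c r μ i x ≤ ∑ j, expTerm c r μ j x :=
    Finset.single_le_sum (fun j _ => (expTerm_pos j x).le) (Finset.mem_univ i)
  have h2 := Real.log_le_log (expTerm_pos i x) h1
  rw [expTerm, Real.log_exp, div_le_iff₀ hμ] at h2
  rw [smooth]
  linarith [norm_le_smoothDist (c := c) (μ := μ) i x]

lemma smooth_le_obj_add (hm : 1 ≤ m) (hμ : 0 < μ) (x : E n) :
    smooth c r μ x ≤ obj c r x + μ * (1 + Real.log m) := by
  have : Nonempty (Fin m) := ⟨⟨0, hm⟩⟩
  have hm' : (0 : ℝ) < m := by exact_mod_cast hm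
  have h1 : ∑ i, expTerm c r μ i x ≤ m * Real.exp ((obj c r x + μ) / μ) := by
    have := Finset.sum_le_card_nsmul Finset.univ (fun i => expTerm c r μ i x)
      (Real.exp ((obj c r x + μ) / μ)) fun i _ => by
        rw [expTerm, Real.exp_le_exp]
        refine div_le_div_of_nonneg_right ?_ hμ.le
        linarith [smoothDist_le (c := c) hμ i x, le_obj (c := c) (r := r) i x]
    simpa using this
  have h2 := Real.log_le_log (sum_expTerm_pos Finset.univ_nonempty x) h1
  rw [Real.log_mul hm'.ne' (Real.exp_pos _).ne', Real.log_exp] at h2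
  have h3 := mul_le_mul_of_nonneg_left h2 hμ.le
  have e : μ * (Real.log m + (obj c r x + μ) / μ) = obj c r x + μ * (1 + Real.log m) := by
    field_simp
    ring
  rw [smooth]
  linarith

lemma obj_nonneg (hm : 1 ≤ m) (hr : ∀ i, 0 ≤ r i) (x : E n) : 0 ≤ obj c r x :=
  le_trans (add_nonneg (norm_nonneg _) (hr ⟨0, hm⟩)) (le_obj ⟨0, hm⟩ x)

/-- The aggregation function is monotone in the smoothing parameter. -/
lemma smooth_mono (hm : 1 ≤ m) {ν : ℝ} (hν : 0 < ν) (h : ν ≤ μ) (x : E n) :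
    smooth c r ν x ≤ smooth c r μ x := by
  have : Nonempty (Fin m) := ⟨⟨0, hm⟩⟩
  have hμ : 0 < μ := hν.trans_le h
  have hs := sum_expTerm_pos (c := c) (r := r) (μ := μ) Finset.univ_nonempty x
  have hsν := sum_expTerm_pos (c := c) (r := r) (μ := ν) Finset.univ_nonempty x
  set s := ∑ i, expTerm c r μ i x with hsdef
  have hp : 1 ≤ μ / ν := (one_le_div hν).2 h
  -- The `ℓ^p` norm is at most the `ℓ^1` norm for `p = μ / ν ≥ 1`: a weight `q ≤ 1` satisfies `q ^ p
  -- ≤ q`.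
  have h1 : ∀ i, expTerm c r ν i x ≤ expTerm c r μ i x / s * s ^ (μ / ν) := by
    intro i
    have hd : smoothDist c ν i x ≤ smoothDist c μ i x := by
      unfold smoothDist; gcongr
    have e1 : expTerm c r ν i x ≤ expTerm c r μ i x ^ (μ / ν) := by
      rw [expTerm, expTerm, ← Real.exp_mul, Real.exp_le_exp]
      have : (smoothDist c μ i x + r i) / μ * (μ / ν) = (smoothDist c μ i x + r i) / ν := by
        field_simp
      rw [this]
      gcongr
    have hq0 : 0 < expTerm c r μ i x / s := div_pos (expTerm_pos i x) hs
    have hq1 : expTerm c r μ i x / s ≤ 1 := (div_le_one hs).2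
      (Finset.single_le_sum (fun j _ => (expTerm_pos j x).le) (Finset.mem_univ i))
    have e2 : (expTerm c r μ i x / s) ^ (μ / ν) ≤ expTerm c r μ i x / s := by
      simpa using Real.rpow_le_rpow_of_exponent_ge hq0 hq1 hp
    rw [Real.div_rpow (expTerm_pos i x).le hs.le, div_le_iff₀ (by positivity)] at e2
    exact e1.trans e2
  have h2 : ∑ i, expTerm c r ν i x ≤ s ^ (μ / ν) := by
    refine (Finset.sum_le_sum fun i _ => h1 i).trans ?_
    rw [← Finset.sum_mul, ← Finset.sum_div, div_self hs.ne', one_mul]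
  have h3 := Real.log_le_log hsν h2
  rw [Real.log_rpow hs] at h3
  have h4 := mul_le_mul_of_nonneg_left h3 hν.le
  have e : ν * (μ / ν * Real.log s) = μ * Real.log s := by field_simp
  rw [e] at h4
  exact h4

/-- Quadratic growth of the objective at its minimizer. -/
lemma norm_sub_sq_le_of_isMin (hm : 1 ≤ m) (hr : ∀ i, 0 ≤ r i) {xstar : E n}
    (hxstar : ∀ y, obj c r xstar ≤ obj c r y) (x : E n) :
    ‖x - xstar‖ ^ 2
      ≤ 2 * (obj c r x - obj c r xstar) * (obj c r x + obj c r xstar) := by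
  have : Nonempty (Fin m) := ⟨⟨0, hm⟩⟩
  -- Parallelogram law about the center `c i` of a ball attaining the maximum at the midpoint `z`,
  -- where the objective is at least its minimum.
  set z : E n := (1 / 2 : ℝ) • (x + xstar) with hz
  obtain ⟨i, hi⟩ := exists_eq_ciSup_of_finite (f := fun i => ‖z - c i‖ + r i)
  have hzi : obj c r xstar ≤ ‖z - c i‖ + r i := (hxstar z).trans_eq hi.symm
  have h1 := le_obj (c := c) (r := r) i x
  have h2 := le_obj (c := c) (r := r) i xstar
  have hx := hxstar x
  have hpar := parallelogram_law_with_norm ℝ (x - c i) (xstar - c i)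
  have e1 : x - c i + (xstar - c i) = (2 : ℝ) • (z - c i) := by rw [hz]; module
  have e2 : x - c i - (xstar - c i) = x - xstar := by abel
  rw [e1, e2, norm_smul, Real.norm_ofNat] at hpar
  have n0 := norm_nonneg (x - c i)
  have n1 := norm_nonneg (xstar - c i)
  have n2 := norm_nonneg (z - c i)
  have q1 : ‖x - c i‖ ^ 2 ≤ (obj c r x - r i) ^ 2 := by gcongr; linarith
  have q2 : ‖xstar - c i‖ ^ 2 ≤ (obj c r xstar - r i) ^ 2 := by gcongr; linarith
  have q3 : (obj c r xstar - r i) ^ 2 ≤ ‖z - c i‖ ^ 2 :=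
    pow_le_pow_left₀ (by linarith) (by linarith) 2
  nlinarith [mul_nonneg (sub_nonneg.2 hx) (hr i)]

end Basic

/-! ### Uniform decrease and termination of an inner loop. -/

section Step

variable {m n : ℕ} {c : Fin m → E n} {r : Fin m → ℝ} {μ ε f₀ σ₀ σ₁ c₁ β : ℝ}

lemma IsDirection.inner_le_and_norm_le (hm : 1 ≤ m) (hμ : 0 < μ ∧ μ ≤ 1) (hε : 0 < ε ∧ ε ≤ 1)
    (hσ : HessBounds c r f₀ μ σ₀ σ₁) {x d : E n} (hx : smooth c r μ x ≤ f₀)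
    (hd : IsDirection c r μ ε x d) :
    inner ℝ d (inexactGrad c r μ ε x) ≤ -(σ₀ * ‖d‖ ^ 2) ∧
      ‖inexactGrad c r μ ε x‖ ≤ 2 * σ₁ * ‖d‖ := by
  obtain ⟨⟨N, hN⟩, hres⟩ := hd
  obtain ⟨h0, h01, hb⟩ := hσ
  have hb' := hb x hx _ (active_nonempty (c := c) (r := r) hm hμ hε x)
  set b := inexactGrad c r μ ε x
  have hsymm : ∀ v w, inner ℝ (inexactHess c r μ ε x v) w
      = inner ℝ v (inexactHess c r μ ε x w) := hess_symm _ x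
  have hlow : ∀ v, σ₀ * ‖v‖ ^ 2 ≤ inner ℝ v (inexactHess c r μ ε x v) := fun v => (hb' v).1
  have hup : ∀ v, inner ℝ v (inexactHess c r μ ε x v) ≤ σ₁ * ‖v‖ ^ 2 := fun v => (hb' v).2
  have hpos : ∀ v, v ≠ 0 → 0 < inner ℝ v (inexactHess c r μ ε x v) := fun v hv =>
    (mul_pos h0 (pow_pos (norm_pos_iff.2 hv) 2)).trans_le (hlow v)
  constructor
  · rw [hN, inner_cg_eq hsymm hpos, ← hN]
    linarith [hlow d]
  · have h1 := norm_apply_le_of_inner_le hsymm (h0.trans_le h01)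
      (fun v => le_trans (by positivity) (hlow v)) hup d
    have h2 : ‖inexactHess c r μ ε x d + b‖ ≤ 1 / 2 * ‖b‖ :=
      hres.trans (mul_le_mul_of_nonneg_right (min_le_left _ _) (norm_nonneg _))
    have h3 := norm_sub_le (inexactHess c r μ ε x d + b) (inexactHess c r μ ε x d)
    rw [add_sub_cancel_left] at h3
    linarith

lemma IsStep.smooth_le (hm : 1 ≤ m) (hμ : 0 < μ ∧ μ ≤ 1) (hε : 0 < ε ∧ ε ≤ 1)
    (hσ : HessBounds c r f₀ μ σ₀ σ₁) (hc₁ : 0 < c₁) (hβ : 0 < β) {x y : E n}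
    (hx : smooth c r μ x ≤ f₀) (hxy : IsStep c r c₁ β μ ε x y) :
    smooth c r μ y ≤ smooth c r μ x := by
  obtain ⟨d, hd, l, hl, rfl⟩ := hxy
  have h1 := (hd.inner_le_and_norm_le hm hμ hε hσ hx).1
  have h2 : smooth c r μ (x + β ^ l • d)
      ≤ smooth c r μ x + c₁ * β ^ l * inner ℝ d (inexactGrad c r μ ε x) := hl.1
  have h3 : c₁ * β ^ l * inner ℝ d (inexactGrad c r μ ε x) ≤ 0 :=
    mul_nonpos_of_nonneg_of_nonpos (by positivity)
      (h1.trans (neg_nonpos.2 (mul_nonneg hσ.1.le (by positivity))))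
  linarith

/-- Short steps give sufficient decrease. -/
lemma IsDirection.sufficient_decrease (hm : 1 ≤ m) (hμ : 0 < μ ∧ μ ≤ 1) (hε : 0 < ε ∧ ε ≤ 1)
    (hσ : HessBounds c r f₀ μ σ₀ σ₁) (hc₁ : c₁ < 1) {e : ℝ}
    (hεe : 6 * μ * σ₁ ^ 2 * ε ≤ 5 * (1 - c₁) * σ₀ ^ 2 * e) {x d : E n}
    (hx : smooth c r μ x ≤ f₀) (hd : IsDirection c r μ ε x d)
    (he : e < ‖inexactGrad c r μ ε x‖) {t : ℝ} (ht : 0 ≤ t) (ht₁ : t ≤ μ * σ₀)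
    (ht₂ : t ≤ (1 - c₁) * σ₀ * μ / 5) :
    smooth c r μ (x + t • d)
      ≤ smooth c r μ x + c₁ * t * inner ℝ d (inexactGrad c r μ ε x) := by
  obtain ⟨h1, h2⟩ := hd.inner_le_and_norm_le hm hμ hε hσ hx
  have herr := norm_grad_sub_inexactGrad_le (c := c) (r := r) hm hμ hε x
  have hb1 : ‖inexactGrad c r μ ε x‖ ≤ 1 := norm_grad_le_one hμ.1 (active_nonempty hm hμ hε x) x
  obtain ⟨h0, h01, -⟩ := hσ
  set b := inexactGrad c r μ ε x
  set g := grad c r μ Finset.univ x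
  set D := ‖d‖ with hD
  have hD0 : 0 ≤ D := norm_nonneg d
  have hμ0 := hμ.1
  -- The inexact gradient has norm at most 1, so `t ≤ μ σ₀` keeps `t • d` within the radius `μ` of
  -- the quadratic model.
  have h1' : σ₀ * D ≤ 1 := by
    by_cases hDz : D = 0
    · rw [hDz]; simp
    have hDp : 0 < D := lt_of_le_of_ne hD0 (Ne.symm hDz)
    have h3 := (abs_le.1 (abs_real_inner_le_norm d b)).1
    have h4 : ‖d‖ * ‖b‖ ≤ D * 1 := mul_le_mul_of_nonneg_left hb1 hD0
    have h5 : (σ₀ * D) * D ≤ 1 * D := by nlinarith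
    exact le_of_mul_le_mul_right h5 hDp
  have hnorm : ‖t • d‖ = t * D := by rw [norm_smul, Real.norm_of_nonneg ht]
  have htd : ‖t • d‖ ≤ μ := by
    rw [hnorm]
    calc t * D ≤ μ * σ₀ * D := by gcongr
      _ = μ * (σ₀ * D) := by ring
      _ ≤ μ * 1 := by gcongr
      _ = μ := mul_one μ
  have hq := smooth_add_le (c := c) (r := r) hm hμ0 x (t • d) htd
  rw [hnorm, inner_smul_right, real_inner_comm d g] at hq
  have hgd : inner ℝ d g ≤ inner ℝ d b + μ * ε / 5 * D := by
    have h3 := (abs_le.1 (abs_real_inner_le_norm d (g - b))).2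
    rw [inner_sub_right] at h3
    have h4 : ‖d‖ * ‖g - b‖ ≤ D * (μ * ε / 5) := mul_le_mul_of_nonneg_left herr hD0
    linarith
  have hmar : μ * ε / 5 ≤ (1 - c₁) * σ₀ / 3 * D := by
    have hσ1 : 0 < σ₁ := h0.trans_le h01
    have h3 : e ≤ 2 * σ₁ * D := he.le.trans h2
    have hk : 0 ≤ 5 * (1 - c₁) * σ₀ ^ 2 := by nlinarith [sq_nonneg σ₀]
    have h4 : 6 * μ * σ₁ ^ 2 * ε ≤ 5 * (1 - c₁) * σ₀ ^ 2 * (2 * σ₁ * D) :=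
      hεe.trans (mul_le_mul_of_nonneg_left h3 hk)
    have h5 : 5 * (1 - c₁) * σ₀ ^ 2 * (2 * σ₁ * D) ≤ 5 * (1 - c₁) * (σ₀ * σ₁) * (2 * σ₁ * D) := by
      have : 0 < 1 - c₁ := by linarith
      rw [sq σ₀]
      gcongr
    have h6 : σ₁ ^ 2 * (6 * μ * ε) ≤ σ₁ ^ 2 * (10 * (1 - c₁) * σ₀ * D) := by nlinarith
    have h7 := le_of_mul_le_mul_left h6 (by positivity)
    linarith
  have hcurv : 3 / (2 * μ) * (t * D) ^ 2 ≤ t * (3 / 10 * ((1 - c₁) * σ₀ * D ^ 2)) := by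
    calc 3 / (2 * μ) * (t * D) ^ 2 = t * (3 / (2 * μ) * t * D ^ 2) := by ring
      _ ≤ t * (3 / (2 * μ) * ((1 - c₁) * σ₀ * μ / 5) * D ^ 2) := by gcongr
      _ = t * (3 / 10 * ((1 - c₁) * σ₀ * D ^ 2)) := by field_simp; ring
  have hmarD : μ * ε / 5 * D ≤ (1 - c₁) * σ₀ / 3 * D * D := mul_le_mul_of_nonneg_right hmar hD0
  have h8 : (1 - c₁) * inner ℝ d b ≤ (1 - c₁) * -(σ₀ * D ^ 2) :=
    mul_le_mul_of_nonneg_left h1 (by linarith)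
  have h9 : 0 ≤ (1 - c₁) * (σ₀ * D ^ 2) := mul_nonneg (by linarith) (by positivity)
  -- Gradient error and curvature use up 1/3 and 3/10 of `(1 - c₁) σ₀ D²`, together less than the
  -- whole.
  have h10 : inner ℝ d g + 3 / 10 * ((1 - c₁) * σ₀ * D ^ 2) ≤ c₁ * inner ℝ d b := by
    nlinarith
  have h11 := mul_le_mul_of_nonneg_left h10 ht
  linarith

/-- A pass of the inner loop from a point where the exit test fails decreases the aggregation
function by an amount bounded away from zero. -/
lemma exists_uniform_decrease (hm : 1 ≤ m) (hμ : 0 < μ ∧ μ ≤ 1) (hε : 0 < ε ∧ ε ≤ 1)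
    (hσ : HessBounds c r f₀ μ σ₀ σ₁) (hc₁ : 0 < c₁ ∧ c₁ < 1) (hβ : 0 < β) {e : ℝ}
    (he0 : 0 < e) (hεe : 6 * μ * σ₁ ^ 2 * ε ≤ 5 * (1 - c₁) * σ₀ ^ 2 * e) :
    ∃ δ > 0, ∀ x y : E n, smooth c r μ x ≤ f₀ → e < ‖inexactGrad c r μ ε x‖ →
      IsStep c r c₁ β μ ε x y → smooth c r μ y ≤ smooth c r μ x - δ := by
  have hσ₀ := hσ.1
  have hσ₁ : 0 < σ₁ := hσ.1.trans_le hσ.2.1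
  have hμ0 := hμ.1
  have hc₁0 := hc₁.1
  have hc₁1 : 0 < 1 - c₁ := by linarith [hc₁.2]
  set τ := min (μ * σ₀) ((1 - c₁) * σ₀ * μ / 5) with hτ
  have hτ0 : 0 < τ := lt_min (by positivity) (by positivity)
  -- Lower bound for the accepted step: either `l = 0`, or the preceding trial step was rejected and
  -- so exceeds `τ`.
  set T := min 1 (β * τ) with hT
  have hT0 : 0 < T := lt_min one_pos (by positivity)
  refine ⟨c₁ * T * (σ₀ * (e / (2 * σ₁)) ^ 2), by positivity, ?_⟩
  rintro x y hx hex ⟨d, hd, l, hl, rfl⟩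
  obtain ⟨h1, h2⟩ := hd.inner_le_and_norm_le hm hμ hε hσ hx
  have hTl : T ≤ β ^ l := by
    cases l with
    | zero => simp [hT]
    | succ l =>
      have hnot : τ < β ^ l := by
        by_contra! hle
        have hmem := hd.sufficient_decrease hm hμ hε hσ hc₁.2 hεe hx hex
          (t := β ^ l) (by positivity) (hle.trans (min_le_left _ _))
          (hle.trans (min_le_right _ _))
        exact absurd (hl.2 hmem) (by omega)
      calc T ≤ β * τ := min_le_right _ _
        _ ≤ β * β ^ l := by gcongr
        _ = β ^ (l + 1) := by ring
  have hdn : e / (2 * σ₁) ≤ ‖d‖ := by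
    rw [div_le_iff₀ (by positivity)]
    linarith
  have h3 : smooth c r μ (x + β ^ l • d)
      ≤ smooth c r μ x + c₁ * β ^ l * inner ℝ d (inexactGrad c r μ ε x) := hl.1
  have h4 : c₁ * T * (σ₀ * (e / (2 * σ₁)) ^ 2) ≤ c₁ * β ^ l * (σ₀ * ‖d‖ ^ 2) := by gcongr
  have h5 : c₁ * β ^ l * inner ℝ d (inexactGrad c r μ ε x) ≤ c₁ * β ^ l * -(σ₀ * ‖d‖ ^ 2) := by
    gcongr
  linarith

/-- A sequence of passes meets the exit test after finitely many passes, and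
stays in the level set until then. -/
lemma exists_exit_of_steps (hm : 1 ≤ m) (hr : ∀ i, 0 ≤ r i) (hμ : 0 < μ ∧ μ ≤ 1)
    (hε : 0 < ε ∧ ε ≤ 1) (hσ : HessBounds c r f₀ μ σ₀ σ₁) (hc₁ : 0 < c₁ ∧ c₁ < 1)
    (hβ : 0 < β) {e : ℝ} (he0 : 0 < e)
    (hεe : 6 * μ * σ₁ ^ 2 * ε ≤ 5 * (1 - c₁) * σ₀ ^ 2 * e) {u : ℕ → E n}
    (hu0 : smooth c r μ (u 0) ≤ f₀)
    (hstep : ∀ j, (∀ i, 1 ≤ i → i ≤ j → ¬ ‖inexactGrad c r μ ε (u i)‖ ≤ e) →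
      IsStep c r c₁ β μ ε (u j) (u (j + 1))) :
    ∃ j, IsLeast {j : ℕ | 1 ≤ j ∧ ‖inexactGrad c r μ ε (u j)‖ ≤ e} j ∧
      smooth c r μ (u j) ≤ f₀ := by
  classical
  have hlev : ∀ j, (∀ i, 1 ≤ i → i < j → ¬ ‖inexactGrad c r μ ε (u i)‖ ≤ e) →
      smooth c r μ (u j) ≤ f₀ := by
    intro j
    induction j with
    | zero => exact fun _ => hu0
    | succ j ih =>
      intro h
      have hj := ih fun i h1 h2 => h i h1 (by omega)
      exact ((hstep j fun i h1 h2 => h i h1 (by omega)).smooth_le hm hμ hε hσ hc₁.1 hβ hj).trans hj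
  have hex : ∃ j, 1 ≤ j ∧ ‖inexactGrad c r μ ε (u j)‖ ≤ e := by
    by_contra! hno
    obtain ⟨δ, hδ, hdec⟩ := exists_uniform_decrease hm hμ hε hσ hc₁ hβ he0 hεe
    -- The exit test is not applied to `u 0`, so the first pass is only known not to increase the
    -- function.
    have hbound : ∀ j : ℕ, smooth c r μ (u (j + 1)) ≤ f₀ - j * δ := by
      intro j
      induction j with
      | zero => simpa using hlev 1 fun i h1 _ => (hno i h1).not_ge
      | succ j ih =>
        have := hdec _ _ (hlev (j + 1) fun i h1 _ => (hno i h1).not_ge) (hno (j + 1) (by omega))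
          (hstep (j + 1) fun i h1 _ => (hno i h1).not_ge)
        push_cast
        linarith
    obtain ⟨N, hN⟩ := exists_nat_gt (f₀ / δ)
    rw [div_lt_iff₀ hδ] at hN
    have h1 := hbound N
    have h2 := (obj_nonneg hm hr (u (N + 1))).trans (obj_le_smooth (c := c) hm hμ.1 (u (N + 1)))
    linarith
  refine ⟨Nat.find hex, ⟨Nat.find_spec hex, fun i hi => Nat.find_min' hex hi⟩, ?_⟩
  exact hlev _ fun i h1 h2 h3 => Nat.find_min hex h2 ⟨h1, h3⟩

end Step

/-- Almost stationary points of the aggregation functions, in a common level set, converge to the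
minimizer of the objective as the smoothing parameter tends to zero. -/
lemma tendsto_of_norm_grad_tendsto {m n : ℕ} (hm : 1 ≤ m) {c : Fin m → E n} {r : Fin m → ℝ}
    (hr : ∀ i, 0 ≤ r i) {μ : ℕ → ℝ} (hμ : ∀ k, 0 < μ k) (hμ_lim : Tendsto μ atTop (𝓝 0))
    {f₀ : ℝ} {y : ℕ → E n} (hy : ∀ k, smooth c r (μ k) (y k) ≤ f₀)
    (hgrad : Tendsto (fun k => ‖grad c r (μ k) Finset.univ (y k)‖) atTop (𝓝 0))
    {xstar : E n} (hxstar : ∀ z, obj c r xstar ≤ obj c r z) :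
    Tendsto y atTop (𝓝 xstar) := by
  have hobj : ∀ k, obj c r (y k) ≤ f₀ := fun k => (obj_le_smooth hm (hμ k) (y k)).trans (hy k)
  have hf0 : 0 ≤ f₀ := (obj_nonneg hm hr (y 0)).trans (hobj 0)
  have hdist : ∀ k, ‖xstar - y k‖ ≤ 2 * f₀ := fun k => by
    have h1 := le_obj (c := c) (r := r) ⟨0, hm⟩ (y k)
    have h2 := le_obj (c := c) (r := r) ⟨0, hm⟩ xstar
    have h3 := norm_sub_le (xstar - c ⟨0, hm⟩) (y k - c ⟨0, hm⟩)
    rw [sub_sub_sub_cancel_right] at h3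
    linarith [hobj k, hxstar (y k), hr ⟨0, hm⟩]
  have hgap : ∀ k, obj c r (y k) - obj c r xstar
      ≤ μ k * (1 + Real.log m) + ‖grad c r (μ k) Finset.univ (y k)‖ * (2 * f₀) := fun k => by
    -- Gradient inequality at `y k` towards `xstar`; smoothing costs at most `μ k (1 + log m)`.
    have h1 := le_smooth_add (c := c) (r := r) hm (hμ k) (y k) (xstar - y k)
    rw [add_sub_cancel] at h1
    have h2 := (abs_le.1 (abs_real_inner_le_norm (grad c r (μ k) Finset.univ (y k))
      (xstar - y k))).1
    have h3 := mul_le_mul_of_nonneg_left (hdist k)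
      (norm_nonneg (grad c r (μ k) Finset.univ (y k)))
    linarith [obj_le_smooth (c := c) (r := r) hm (hμ k) (y k),
      smooth_le_obj_add (c := c) (r := r) hm (hμ k) xstar]
  have hsq : ∀ k, ‖y k - xstar‖ ^ 2 ≤ 4 * f₀ *
      (μ k * (1 + Real.log m) + ‖grad c r (μ k) Finset.univ (y k)‖ * (2 * f₀)) := fun k => by
    have h1 := norm_sub_sq_le_of_isMin hm hr hxstar (y k)
    have h2 : 0 ≤ obj c r (y k) - obj c r xstar := sub_nonneg.2 (hxstar _)
    have h3 : obj c r (y k) + obj c r xstar ≤ 2 * f₀ := by linarith [hobj k]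
    calc _ ≤ _ := h1
      _ ≤ 2 * (obj c r (y k) - obj c r xstar) * (2 * f₀) := by gcongr
      _ = 4 * f₀ * (obj c r (y k) - obj c r xstar) := by ring
      _ ≤ _ := by gcongr; exact hgap k
  have hlim : Tendsto (fun k => 4 * f₀ *
      (μ k * (1 + Real.log m) + ‖grad c r (μ k) Finset.univ (y k)‖ * (2 * f₀))) atTop (𝓝 0) := by
    have := ((hμ_lim.mul_const (1 + Real.log m)).add (hgrad.mul_const (2 * f₀))).const_mul (4 * f₀)
    simpa using this
  have h0 : Tendsto (fun k => ‖y k - xstar‖ ^ 2) atTop (𝓝 0) :=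
    squeeze_zero (fun k => by positivity) hsq hlim
  have h1 := h0.sqrt
  simp only [Real.sqrt_sq (norm_nonneg _), Real.sqrt_zero] at h1
  exact tendsto_iff_norm_sub_tendsto_zero.2 h1

end SEB

/-! ### The outer loop. -/

theorem mainTheorem2 (m n : ℕ) (hm : 1 ≤ m)
    (c : Fin m → SEB.E n) (r : Fin m → ℝ) (hr : ∀ i, 0 ≤ r i)
    (ε₁ c₁ β : ℝ) (hε₁ : ε₁ = 0) (hc₁ : 0 < c₁ ∧ c₁ < 1) (hβ : 0 < β ∧ β < 1)
    (μ : ℕ → ℝ) (hμ : ∀ k, 0 < μ k ∧ μ k ≤ 1) (hμ_anti : Antitone μ)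
    (hμ_lim : Tendsto μ atTop (𝓝 0))
    (ε₂ ε₃ c₂ σmin σmax : ℝ → ℝ) (x₀₀ : SEB.E n)
    (hε₂ : Tendsto (fun k => ε₂ (μ k)) atTop (𝓝 0))
    (hσ : ∀ k, SEB.HessBounds c r (SEB.smooth c r (μ 0) x₀₀) (μ k) (σmin (μ k)) (σmax (μ k)))
    (hc₂ : ∀ k, 6 * μ k * σmax (μ k) ^ 2 / (5 * (1 - c₁) * σmin (μ k) ^ 2) < c₂ (μ k))
    (hε₃ : ∀ k, 0 < ε₃ (μ k) ∧ ε₃ (μ k) ≤ 1)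
    (hε₃₂ : ∀ k, ε₃ (μ k) ≤ ε₂ (μ k) / c₂ (μ k))
    (x : ℕ → ℕ → SEB.E n) (hx : SEB.IsRun c r ε₁ c₁ β μ ε₂ ε₃ x₀₀ x)
    (xstar : SEB.E n) (hxstar : ∀ y, SEB.obj c r xstar ≤ SEB.obj c r y) :
    ∃ J : ℕ → ℕ, (∀ k, SEB.IsExit c r μ ε₂ ε₃ x k (J k)) ∧
      Tendsto (fun k => x k (J k)) atTop (𝓝 xstar) := by
  set f₀ := SEB.smooth c r (μ 0) x₀₀
  have hc₁1 : 0 < 1 - c₁ := by linarith [hc₁.2]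
  have hloop : ∀ k, SEB.Enters c r ε₁ μ ε₂ ε₃ x k → SEB.smooth c r (μ k) (x k 0) ≤ f₀ →
      ∃ j, SEB.IsExit c r μ ε₂ ε₃ x k j ∧ SEB.smooth c r (μ k) (x k j) ≤ f₀ := by
    intro k hk hk0
    have hμk := (hμ k).1
    have hσ₀ := (hσ k).1
    have hσ₁ : 0 < σmax (μ k) := hσ₀.trans_le (hσ k).2.1
    have hq : 0 < 5 * (1 - c₁) * σmin (μ k) ^ 2 := by positivity
    have hc₂0 : 0 < c₂ (μ k) := lt_trans (by positivity) (hc₂ k)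
    have h1 : ε₃ (μ k) * c₂ (μ k) ≤ ε₂ (μ k) := (le_div_iff₀ hc₂0).1 (hε₃₂ k)
    -- Positivity of the tolerance is not assumed; it follows from that of `ε₃` and `c₂`.
    have he0 : 0 < ε₂ (μ k) := (mul_pos (hε₃ k).1 hc₂0).trans_le h1
    refine SEB.exists_exit_of_steps hm hr (hμ k) (hε₃ k) (hσ k) hc₁ hβ.1 he0 ?_ hk0
      fun j hj => hx.step k j hk hj
    have h2 := (div_lt_iff₀ hq).1 (hc₂ k)
    calc 6 * μ k * σmax (μ k) ^ 2 * ε₃ (μ k)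
        ≤ c₂ (μ k) * (5 * (1 - c₁) * σmin (μ k) ^ 2) * ε₃ (μ k) :=
          mul_le_mul_of_nonneg_right h2.le (hε₃ k).1.le
      _ = 5 * (1 - c₁) * σmin (μ k) ^ 2 * (ε₃ (μ k) * c₂ (μ k)) := by ring
      _ ≤ 5 * (1 - c₁) * σmin (μ k) ^ 2 * ε₂ (μ k) := mul_le_mul_of_nonneg_left h1 hq.le
  -- Entry and the level set bound go by joint induction: termination of loop `k` needs both, and
  -- gives both for the next loop.
  have hall : ∀ k, SEB.Enters c r ε₁ μ ε₂ ε₃ x k ∧ SEB.smooth c r (μ k) (x k 0) ≤ f₀ := by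
    intro k
    induction k with
    | zero =>
      refine ⟨fun i hi => absurd hi (Nat.not_lt_zero i), ?_⟩
      rw [hx.start]
    | succ k ih =>
      obtain ⟨j, hj, hjf⟩ := hloop k ih.1 ih.2
      have hent : SEB.Enters c r ε₁ μ ε₂ ε₃ x (k + 1) := by
        intro i hi
        rcases Nat.lt_succ_iff_lt_or_eq.1 hi with hi | rfl
        · exact ih.1 i hi
        · exact ⟨⟨j, hj⟩, hε₁ ▸ (hμ (i + 1)).1⟩
      refine ⟨hent, ?_⟩
      rw [hx.next k j hent hj]
      exact (SEB.smooth_mono hm (hμ (k + 1)).1 (hμ_anti (Nat.le_succ k)) (x k j)).trans hjf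
  choose J hJ hJf using fun k => hloop k (hall k).1 (hall k).2
  refine ⟨J, hJ, SEB.tendsto_of_norm_grad_tendsto hm hr (fun k => (hμ k).1) hμ_lim hJf ?_ hxstar⟩
  have hle : ∀ k, ‖SEB.grad c r (μ k) Finset.univ (x k (J k))‖ ≤ ε₂ (μ k) + μ k / 5 := by
    intro k
    have h1 : ‖SEB.inexactGrad c r (μ k) (ε₃ (μ k)) (x k (J k))‖ ≤ ε₂ (μ k) := (hJ k).1.2
    have h2 := SEB.norm_grad_sub_inexactGrad_le (c := c) (r := r) hm (hμ k) (hε₃ k) (x k (J k))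
    have h3 := norm_le_norm_add_norm_sub (SEB.inexactGrad c r (μ k) (ε₃ (μ k)) (x k (J k)))
      (SEB.grad c r (μ k) Finset.univ (x k (J k)))
    have h4 := mul_le_of_le_one_right (hμ k).1.le (hε₃ k).2
    rw [norm_sub_rev] at h3
    linarith
  refine squeeze_zero (fun k => norm_nonneg _) hle ?_
  simpa using hε₂.add (hμ_lim.div_const 5)
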